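/- Let $\mathbb{K}$ be $\mathbb{R}$ or $\mathbb{C}$, let $J_1,J_2,J_3$ be positive integers and let $\tau>1$, $0<p<1$. Put $$\psi_{\tau,p}(x)=\begin{cases}|x|-\dfrac{|x|^{1+p}}{(1+p)\tau}, & |x|\le \tau^{1/p},\\[2mm] \dfrac{p\,\tau^{1/p}}{1+p}, & |x|>\tau^{1/p}.\end{cases}$$ For a third-order tensor $\mathcal{B}\in\mathbb{K}^{J_1\times J_2\times J_3}$ with frontal slices $\mathcal{B}^{(1)},\dots,\mathcal{B}^{(J_3)}\in\mathbb{K}^{J_1\times J_2}$, let $\bar{\mathcal{B}}^{(k)}=\sum_{l=1}^{J_3}\omega^{(k-1)(l-1)}\mathcal{B}^{(l)}\in\mathbb{C}^{J_1\times J_2}$, with $\omega=e^{-2\pi\sqrt{-1}/J_3}$, be the frontal slices of its discrete Fourier transform along the third mode, and define the tensor $p$-th order $\tau$ norm $$\|\mathcal{B}\|_{\tau p}=\frac1{J_3}\sum_{j=1}^{J_3}\sum_{i=1}^{\min(J_1,J_2)}\psi_{\tau,p}\bigl(\sigma_i(\bar{\mathcal{B}}^{(j)})\bigr),$$ where $\sigma_i(A)$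 is the $i$-th singular value of the matrix $A$. The t-product of $\mathcal{A}\in\mathbb{K}^{J_1\times J_2\times J_3}$ and $\mathcal{B}\in\mathbb{K}^{J_2\times I\times J_3}$ is the tensor $\mathcal{A}*\mathcal{B}\in\mathbb{K}^{J_1\times I\times J_3}$ obtained by multiplying the block circulant matrix of $\mathcal{A}$ with the column of frontal slices of $\mathcal{B}$, i.e. $(\mathcal{A}*\mathcal{B})^{(k)}=\sum_{l=1}^{J_3}\mathcal{A}^{(k-l+1)}\mathcal{B}^{(l)}$ with slice indices modulo $J_3$. The conjugate transpose $\mathcal{Q}^H$ is obtained by conjugate transposing every frontal slice and reversing the order of the slices $2,\dots,J_3$; the identity tensor $\mathcal{I}$ has first frontal slice the identity matrix and all others zero; $\mathcal{Q}\in\mathbb{K}^{J\times J\times J_3}$ is unitary (orthogonal if $\mathbb{K}=\mathbb{R}$) if $\mathcal{Q}*\mathcal{Q}^H=\mathcal{Q}^H*\mathcal{Q}=\mathcal{I}$. Then: 1. (Non-negativity) $\|\mathcal{B}\|_{\tau p}\ge 0$ for every $\mathcal{B}\in\mathbb{K}^{J_1\times J_2\times J_3}$, with equality if and only if $\mathcal{B}=0$.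 2. (Unitary invariance) $\|\mathcal{U}*\mathcal{B}*\mathcal{V}\|_{\tau p}=\|\mathcal{B}\|_{\tau p}$ for every $\mathcal{B}\in\mathbb{K}^{J_1\times J_2\times J_3}$ and all unitary tensors $\mathcal{U}\in\mathbb{K}^{J_1\times J_1\times J_3}$ and $\mathcal{V}\in\mathbb{K}^{J_2\times J_2\times J_3}$. 3. (Triangle inequality) $\|\mathcal{C}-\mathcal{D}\|_{\tau p}\ge\|\mathcal{C}\|_{\tau p}-\|\mathcal{D}\|_{\tau p}$ for all $\mathcal{C},\mathcal{D}\in\mathbb{K}^{J_1\times J_2\times J_3}$. -/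

import Mathlib

noncomputable section

namespace MPCP

/-- The minimax `p`-th order concave penalty (MPCP) function `ψ_{τ,p} : ℝ → ℝ`. -/
def mpcp (τ p x : ℝ) : ℝ :=
  if |x| ≤ τ ^ (1 / p) then |x| - |x| ^ (1 + p) / ((1 + p) * τ)
  else p * τ ^ (1 / p) / (1 + p)

/-- Third-order tensors of size `J₁ × J₂ × J₃`, given by their frontal slices: `B k` is the
`k`-th frontal slice (counted from `0`) and `B k i j` is the entry at position `(i, j, k)`.
Zero, addition and subtraction are entrywise. -/
abbrev Tensor (𝕜 : Type*) (J₁ J₂ J₃ : ℕ) : Type _ := Fin J₃ → Matrix (Fin J₁) (Fin J₂) 𝕜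

section Algebra

variable {𝕜 : Type*} {J₁ J₂ I J₃ : ℕ}

/-- The block circulant matrix of a tensor: the block in block row `k` and block column `l` is the
frontal slice with index `k - l` modulo `J₃`. -/
def bcirc (B : Tensor 𝕜 J₁ J₂ J₃) : Matrix (Fin J₃ × Fin J₁) (Fin J₃ × Fin J₂) 𝕜 :=
  Matrix.of fun r c => B (r.1 - c.1) r.2 c.2

/-- Block vectorization: the frontal slices stacked on top of each other. -/
def bvec (B : Tensor 𝕜 J₁ J₂ J₃) : Matrix (Fin J₃ × Fin J₁) (Fin J₂) 𝕜 :=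
  Matrix.of fun r j => B r.1 r.2 j

/-- The inverse of block vectorization. -/
def bvfold (M : Matrix (Fin J₃ × Fin J₁) (Fin J₂) 𝕜) : Tensor 𝕜 J₁ J₂ J₃ :=
  fun k => Matrix.of fun i j => M (k, i) j

/-- The t-product of third-order tensors. -/
def tProd [NonUnitalNonAssocSemiring 𝕜] (B : Tensor 𝕜 J₁ J₂ J₃) (C : Tensor 𝕜 J₂ I J₃) :
    Tensor 𝕜 J₁ I J₃ :=
  bvfold (bcirc B * bvec C)

/-- The identity tensor: the first frontal slice is the identity matrix, all others vanish. -/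
def idTensor (𝕜 : Type*) [Zero 𝕜] [One 𝕜] (J₁ J₃ : ℕ) [NeZero J₃] : Tensor 𝕜 J₁ J₁ J₃ :=
  fun k => if k = 0 then 1 else 0

/-- The conjugate transpose of a tensor: every frontal slice is conjugate transposed, the first
one stays in place and the order of the others is reversed (index `k` goes to `-k` modulo `J₃`). -/
def tConjTranspose [Star 𝕜] (B : Tensor 𝕜 J₁ J₂ J₃) : Tensor 𝕜 J₂ J₁ J₃ :=
  fun k => (B (-k)).conjTranspose

/-- Unitary tensors (called orthogonal when the entries are real). -/
def IsUnitary [NonUnitalNonAssocSemiring 𝕜] [One 𝕜] [Star 𝕜] [NeZero J₃]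
    (Q : Tensor 𝕜 J₁ J₁ J₃) : Prop :=
  tProd Q (tConjTranspose Q) = idTensor 𝕜 J₁ J₃ ∧ tProd (tConjTranspose Q) Q = idTensor 𝕜 J₁ J₃

end Algebra

section Norm

variable {𝕜 : Type*} [RCLike 𝕜] {J₁ J₂ J₃ : ℕ}

/-- A real or complex scalar, regarded as a complex number. -/
def toComplex (z : 𝕜) : ℂ := ⟨RCLike.re z, RCLike.im z⟩

/-- The (unnormalized) discrete Fourier transform along the third mode, with
`ω = exp (-2π√-1 / J₃)`. -/
def fft (B : Tensor 𝕜 J₁ J₂ J₃) : Tensor ℂ J₁ J₂ J₃ :=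
  fun k => Matrix.of fun i j =>
    ∑ l : Fin J₃,
      Complex.exp (-(2 * Real.pi * Complex.I) / J₃) ^ ((k : ℕ) * (l : ℕ)) * toComplex (B l i j)

/-- The `i`-th singular value (counted from `0`, in decreasing order) of a complex matrix. -/
def singularValue {m n : ℕ} (A : Matrix (Fin m) (Fin n) ℂ) (i : ℕ) : ℝ :=
  (Matrix.toEuclideanLin A).singularValues i

/-- The `p`-th order `τ` norm of a matrix: the sum of `ψ_{τ,p}` over its `min m n` singular
values. -/
def matrixNorm (τ p : ℝ) {m n : ℕ} (A : Matrix (Fin m) (Fin n) ℂ) : ℝ :=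
  ∑ i : Fin (min m n), mpcp τ p (singularValue A i)

/-- The tensor `p`-th order `τ` norm. -/
def tensorNorm (τ p : ℝ) (B : Tensor 𝕜 J₁ J₂ J₃) : ℝ :=
  1 / (J₃ : ℝ) * ∑ k : Fin J₃, matrixNorm τ p (fft B k)

end Norm

end MPCP

end

/-! The discrete Fourier transform is injective and turns t-products into slicewise matrix products
and unitary tensors into unitary slices, so everything reduces to singular values of complex
matrices. The substance is subadditivity.

On `[0, ∞)` the penalty is a mixture of truncations: `ψ(x) = ∫ min(x, t) (p/τ) t^(p-1) dt` over `0 ≤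
t ≤ τ^(1/p)`. As the weight is nonnegative, it suffices to show for each `t ≥ 0` that `∑ min(σ_k(T),
t)` is subadditive in `T` (`sum_min_singularValues_add_le`).

If `T = X + Y` with `rank Y ≤ r`, Weyl's inequality `σ_{k+r}(T) ≤ σ_k(X)` bounds this sum by `‖X‖_tr
+ r t`. Joining singular value decompositions of `A` and `B` writes `A + B` as a sum of rank one
maps; those of weight at most `t` form `X`, the others `Y`. Each then costs the minimum of its
weight and `t`, which gives the claim. -/

namespace LinearMap

/-! ### Singular values: Weyl's inequality and truncated sums -/

open Module

variable {𝕜 E F E' F' G : Type*} [RCLike 𝕜]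
  [NormedAddCommGroup E] [InnerProductSpace 𝕜 E] [FiniteDimensional 𝕜 E]
  [NormedAddCommGroup F] [InnerProductSpace 𝕜 F] [FiniteDimensional 𝕜 F]
  [NormedAddCommGroup E'] [InnerProductSpace 𝕜 E'] [FiniteDimensional 𝕜 E']
  [NormedAddCommGroup F'] [InnerProductSpace 𝕜 F'] [FiniteDimensional 𝕜 F']
  [AddCommGroup G] [Module 𝕜 G]

/-- An orthonormal basis of right singular vectors. -/
noncomputable def rightSingularBasis (T : E →ₗ[𝕜] F) :
    OrthonormalBasis (Fin (finrank 𝕜 E)) 𝕜 E :=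
  T.isSymmetric_adjoint_comp_self.eigenvectorBasis rfl

lemma adjoint_apply_rightSingularBasis (T : E →ₗ[𝕜] F) (i : Fin (finrank 𝕜 E)) :
    adjoint T (T (T.rightSingularBasis i)) =
      ((T.singularValues i ^ 2 : ℝ) : 𝕜) • T.rightSingularBasis i := by
  rw [T.sq_singularValues_fin rfl]
  exact T.isSymmetric_adjoint_comp_self.apply_eigenvectorBasis rfl i

lemma inner_apply_rightSingularBasis (T : E →ₗ[𝕜] F) (i : Fin (finrank 𝕜 E)) (x : E) :
    inner 𝕜 (T (T.rightSingularBasis i)) (T x) =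
      ((T.singularValues i ^ 2 : ℝ) : 𝕜) * inner 𝕜 (T.rightSingularBasis i) x := by
  rw [← adjoint_inner_left, adjoint_apply_rightSingularBasis, inner_smul_left]
  simp

lemma norm_apply_rightSingularBasis (T : E →ₗ[𝕜] F) (i : Fin (finrank 𝕜 E)) :
    ‖T (T.rightSingularBasis i)‖ = T.singularValues i := by
  have h := T.inner_apply_rightSingularBasis i (T.rightSingularBasis i)
  rw [inner_self_eq_norm_sq_to_K, inner_self_eq_norm_sq_to_K] at h
  simp only [OrthonormalBasis.norm_eq_one, map_one, one_pow, mul_one] at h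
  have h' : ‖T (T.rightSingularBasis i)‖ ^ 2 = T.singularValues i ^ 2 := by exact_mod_cast h
  exact (sq_eq_sq₀ (norm_nonneg _) (T.singularValues_nonneg i)).1 h'

lemma norm_apply_sq_eq_sum (T : E →ₗ[𝕜] F) (x : E) :
    ‖T x‖ ^ 2 = ∑ i : Fin (finrank 𝕜 E), T.singularValues i ^ 2 * ‖inner 𝕜 (T.rightSingularBasis i) x‖ ^ 2 := by
  have h : inner 𝕜 (T x) (T x) = ∑ i : Fin (finrank 𝕜 E), ((T.singularValues i ^ 2 *
      ‖inner 𝕜 (T.rightSingularBasis i) x‖ ^ 2 : ℝ) : 𝕜) := by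
    conv_lhs => rw [← adjoint_inner_right,
      ← T.rightSingularBasis.sum_inner_mul_inner x (adjoint T (T x))]
    refine Finset.sum_congr rfl fun i _ => ?_
    rw [adjoint_inner_right, inner_apply_rightSingularBasis, mul_left_comm,
      ← inner_conj_symm x, RCLike.conj_mul]
    push_cast
    rfl
  rw [inner_self_eq_norm_sq_to_K] at h
  exact_mod_cast h

/-- A common form of Weyl's inequality and of the monotonicity of singular values. -/
lemma singularValues_add_le (T : E →ₗ[𝕜] F) (T' : E' →ₗ[𝕜] F') (L : E →ₗ[𝕜] E')
    (Y : E →ₗ[𝕜] G) {r : ℕ} (hr : finrank 𝕜 (range Y) ≤ r) (hL : ∀ x, ‖L x‖ ≤ ‖x‖)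
    (h : ∀ x, Y x = 0 → ‖T x‖ ≤ ‖T' (L x)‖) (i : ℕ) :
    T.singularValues (i + r) ≤ T'.singularValues i := by
  rcases le_or_gt (finrank 𝕜 E) (i + r) with hk | hk
  · rw [T.singularValues_of_finrank_le hk]
    exact T'.singularValues_nonneg i
  -- The target of `Ψ` has dimension at most `r + (n - 1 - (i + r)) + i = n - 1`, where `n = finrank
  -- 𝕜 E`, so some `w ≠ 0` satisfies all the constraints at once.
  let Ψ : E →ₗ[𝕜] range Y × ({j : Fin (finrank 𝕜 E) // i + r < j} → 𝕜) ×
      ({j : Fin (finrank 𝕜 E') // j < i} → 𝕜) :=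
    Y.rangeRestrict.prod ((LinearMap.pi fun j => innerₛₗ 𝕜 (T.rightSingularBasis j.1)).prod
      (LinearMap.pi fun j => innerₛₗ 𝕜 (T'.rightSingularBasis j.1) ∘ₗ L))
  have hc₁ : Fintype.card {j : Fin (finrank 𝕜 E) // i + r < j} ≤ finrank 𝕜 E - 1 - (i + r) := by
    rw [← Fintype.card_fin (finrank 𝕜 E - 1 - (i + r))]
    refine Fintype.card_le_of_injective (fun j => ⟨j.1 - (i + r + 1), by
      have := j.1.2; have := j.2; omega⟩) fun a b hab => ?_
    have := a.2; have := b.2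
    simp only [Fin.mk.injEq] at hab
    exact Subtype.ext (Fin.ext (by omega))
  have hc₂ : Fintype.card {j : Fin (finrank 𝕜 E') // j < i} ≤ i := by
    conv_rhs => rw [← Fintype.card_fin i]
    refine Fintype.card_le_of_injective (fun j => ⟨j.1, j.2⟩) fun a b hab => ?_
    simp only [Fin.mk.injEq] at hab
    exact Subtype.ext (Fin.ext hab)
  have hker : ker Ψ ≠ ⊥ := by
    refine LinearMap.ker_ne_bot_of_finrank_lt ?_
    rw [finrank_prod, finrank_prod, finrank_fintype_fun_eq_card, finrank_fintype_fun_eq_card]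
    omega
  obtain ⟨w, hw, hw0⟩ := (Submodule.ne_bot_iff _).1 hker
  have hΨ : Ψ w = 0 := hw
  have hY : Y w = 0 := congrArg (fun z => (z.1 : G)) hΨ
  have h₁ : ∀ j : Fin (finrank 𝕜 E), i + r < j → inner 𝕜 (T.rightSingularBasis j) w = 0 :=
    fun j hj => congrFun (congrArg (fun z => z.2.1) hΨ) ⟨j, hj⟩
  have h₂ : ∀ j : Fin (finrank 𝕜 E'), j < i → inner 𝕜 (T'.rightSingularBasis j) (L w) = 0 :=
    fun j hj => congrFun (congrArg (fun z => z.2.2) hΨ) ⟨j, hj⟩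
  have hlow : T.singularValues (i + r) ^ 2 * ‖w‖ ^ 2 ≤ ‖T w‖ ^ 2 := by
    rw [T.norm_apply_sq_eq_sum, ← T.rightSingularBasis.sum_sq_norm_inner_right w, Finset.mul_sum]
    refine Finset.sum_le_sum fun j _ => ?_
    rcases lt_or_ge (i + r) (j : ℕ) with hj | hj
    · simp [h₁ j hj]
    · have := T.singularValues_antitone hj
      have := T.singularValues_nonneg (i + r)
      gcongr
  have hupp : ‖T' (L w)‖ ^ 2 ≤ T'.singularValues i ^ 2 * ‖L w‖ ^ 2 := by
    rw [T'.norm_apply_sq_eq_sum, ← T'.rightSingularBasis.sum_sq_norm_inner_right (L w),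
      Finset.mul_sum]
    refine Finset.sum_le_sum fun j _ => ?_
    rcases lt_or_ge (j : ℕ) i with hj | hj
    · simp [h₂ j hj]
    · have := T'.singularValues_antitone hj
      have := T'.singularValues_nonneg j
      gcongr
  have hw' : 0 < ‖w‖ ^ 2 := by positivity
  have hfin : T.singularValues (i + r) ^ 2 * ‖w‖ ^ 2 ≤ T'.singularValues i ^ 2 * ‖w‖ ^ 2 := by
    calc _ ≤ ‖T w‖ ^ 2 := hlow
      _ ≤ ‖T' (L w)‖ ^ 2 := by gcongr; exact h w hY
      _ ≤ T'.singularValues i ^ 2 * ‖L w‖ ^ 2 := hupp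
      _ ≤ _ := by gcongr; exact hL w
  exact le_of_sq_le_sq (le_of_mul_le_mul_right hfin hw') (T'.singularValues_nonneg i)

lemma singularValues_le_of_norm_le (T : E →ₗ[𝕜] F) (T' : E' →ₗ[𝕜] F') (L : E →ₗ[𝕜] E')
    (hL : ∀ x, ‖L x‖ ≤ ‖x‖) (h : ∀ x, ‖T x‖ ≤ ‖T' (L x)‖) (i : ℕ) :
    T.singularValues i ≤ T'.singularValues i :=
  singularValues_add_le T T' L (0 : E →ₗ[𝕜] 𝕜) (r := 0) (by simp) hL (fun x _ => h x) i

/-- Serves unitary invariance: a left unitary factor preserves `‖T x‖`, and a right one becomes `e`.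
-/
lemma singularValues_eq_of_norm_eq (T : E →ₗ[𝕜] F) (T' : E' →ₗ[𝕜] F') (e : E ≃ₗᵢ[𝕜] E')
    (h : ∀ x, ‖T x‖ = ‖T' (e x)‖) : T.singularValues = T'.singularValues := by
  ext i
  refine le_antisymm ?_ ?_
  · exact singularValues_le_of_norm_le T T' e.toLinearEquiv.toLinearMap
      (fun x => (e.norm_map x).le) (fun x => (h x).le) i
  · refine singularValues_le_of_norm_le T' T e.symm.toLinearEquiv.toLinearMap
      (fun x => (e.symm.norm_map x).le) (fun x => ?_) i
    have := h (e.symm x)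
    simp only [LinearIsometryEquiv.apply_symm_apply] at this
    exact this.ge

/-- Bessel's inequality for the left singular vectors. Since `0⁻¹ = 0`, indices with zero singular
value contribute nothing. -/
lemma sum_sq_norm_inner_apply_rightSingularBasis_le (X : E →ₗ[𝕜] F) (w : F) :
    ∑ k : Fin (finrank 𝕜 E),
      ‖inner 𝕜 ((((X.singularValues k)⁻¹ : ℝ) : 𝕜) • X (X.rightSingularBasis k)) w‖ ^ 2 ≤
      ‖w‖ ^ 2 := by
  set y : Fin (finrank 𝕜 E) → F :=
    fun k => (((X.singularValues k)⁻¹ : ℝ) : 𝕜) • X (X.rightSingularBasis k) with hy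
  let S : Finset (Fin (finrank 𝕜 E)) := {k | X.singularValues k ≠ 0}
  have hon : Orthonormal 𝕜 fun k : S => y k := by
    rw [orthonormal_iff_ite]
    rintro ⟨a, ha⟩ ⟨b, hb⟩
    have ha' : X.singularValues a ≠ 0 := by simpa [S] using ha
    simp only [hy, inner_smul_left, inner_smul_right, inner_apply_rightSingularBasis,
      orthonormal_iff_ite.1 X.rightSingularBasis.orthonormal, Subtype.mk.injEq]
    split_ifs with hab
    · subst hab
      have : ((X.singularValues a : ℝ) : 𝕜) ≠ 0 := by exact_mod_cast ha'
      simp only [RCLike.conj_ofReal]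
      push_cast
      field_simp
    · simp
  have h0 : ∀ k ∉ S, ‖inner 𝕜 (y k) w‖ ^ 2 = 0 := by
    intro k hk
    have : X.singularValues k = 0 := by simpa [S] using hk
    simp [hy, this]
  rw [← Finset.sum_subset (Finset.subset_univ S) fun k _ hk => h0 k hk, ← Finset.sum_coe_sort S]
  exact hon.sum_inner_products_le w

/-- The trace norm is at most the total weight of a decomposition into rank one maps. -/
lemma sum_singularValues_le {ι : Type*} (S : Finset ι) (v : ι → E) (w : ι → F)
    (hv : ∀ j ∈ S, ‖v j‖ ≤ 1) (X : E →ₗ[𝕜] F) (hX : ∀ x, X x = ∑ j ∈ S, inner 𝕜 (v j) x • w j) :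
    ∑ k : Fin (finrank 𝕜 E), X.singularValues k ≤ ∑ j ∈ S, ‖w j‖ := by
  set e := X.rightSingularBasis with he
  set y : Fin (finrank 𝕜 E) → F :=
    fun k => (((X.singularValues k)⁻¹ : ℝ) : 𝕜) • X (e k) with hy
  have h1 : ∀ k : Fin (finrank 𝕜 E), X.singularValues k ≤
      ∑ j ∈ S, ‖inner 𝕜 (v j) (e k)‖ * ‖inner 𝕜 (y k) (w j)‖ := by
    intro k
    have h2 : inner 𝕜 (y k) (X (e k)) = ((X.singularValues k : ℝ) : 𝕜) := by
      simp only [hy, inner_smul_left, inner_self_eq_norm_sq_to_K, he,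
        norm_apply_rightSingularBasis, RCLike.conj_ofReal]
      rcases eq_or_ne (X.singularValues k) 0 with h0 | h0
      · simp [h0]
      · have : ((X.singularValues k : ℝ) : 𝕜) ≠ 0 := by exact_mod_cast h0
        push_cast
        field_simp
    have h3 : X.singularValues k = ‖inner 𝕜 (y k) (X (e k))‖ := by
      rw [h2, RCLike.norm_ofReal, abs_of_nonneg (X.singularValues_nonneg k)]
    rw [h3, hX (e k), inner_sum]
    refine (norm_sum_le _ _).trans (Finset.sum_le_sum fun j _ => ?_)
    rw [inner_smul_right, norm_mul]
  refine (Finset.sum_le_sum fun k _ => h1 k).trans ?_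
  rw [Finset.sum_comm]
  refine Finset.sum_le_sum fun j hj => ?_
  -- Cauchy–Schwarz over `k` for each fixed `j`: Parseval handles the factor with `v j`, Bessel the
  -- one with `w j`.
  refine (Real.sum_mul_le_sqrt_mul_sqrt _ _ _).trans ?_
  have hb := sum_sq_norm_inner_apply_rightSingularBasis_le X (w j)
  rw [e.sum_sq_norm_inner_left, Real.sqrt_sq (norm_nonneg _)]
  calc _ ≤ 1 * ‖w j‖ := by
        gcongr
        · exact hv j hj
        · exact Real.sqrt_le_iff.2 ⟨norm_nonneg _, hb⟩
    _ = _ := one_mul _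

/-- The first `r` terms are at most `t` each; Weyl's inequality bounds the others by the singular
values of `X`. -/
lemma sum_min_singularValues_le_of_add (T X Y : E →ₗ[𝕜] F) (hT : T = X + Y) {r : ℕ}
    (hr : finrank 𝕜 (range Y) ≤ r) {t : ℝ} (ht : 0 ≤ t) :
    ∑ k : Fin (finrank 𝕜 E), min (T.singularValues k) t ≤
      ∑ k : Fin (finrank 𝕜 E), X.singularValues k + r * t := by
  set n := finrank 𝕜 E
  rw [Fin.sum_univ_eq_sum_range (fun k => min (T.singularValues k) t),
    Fin.sum_univ_eq_sum_range (fun k => X.singularValues k)]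
  have h0 : ∀ k, 0 ≤ min (T.singularValues k) t := fun k => le_min (T.singularValues_nonneg k) ht
  -- Lengthening the range to `r + n` avoids the difference `n - r` and covers `r > n`.
  calc ∑ k ∈ Finset.range n, min (T.singularValues k) t
      ≤ ∑ k ∈ Finset.range (r + n), min (T.singularValues k) t :=
        Finset.sum_le_sum_of_subset_of_nonneg (Finset.range_subset_range.2 (by omega))
          fun k _ _ => h0 k
    _ = ∑ k ∈ Finset.range r, min (T.singularValues k) t +
        ∑ k ∈ Finset.range n, min (T.singularValues (r + k)) t :=
        Finset.sum_range_add _ _ _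
    _ ≤ ∑ k ∈ Finset.range r, t + ∑ k ∈ Finset.range n, X.singularValues k := by
        gcongr with k _ k _
        · exact min_le_right _ _
        · refine (min_le_left _ _).trans ?_
          rw [add_comm r k]
          exact singularValues_add_le T X LinearMap.id Y hr (fun x => le_rfl)
            (fun x hx => by simp [hT, hx]) k
    _ = _ := by simp [add_comm]

/-- Rank one terms with `‖w j‖ ≤ t` are charged to the trace norm, the remaining ones to the rank at
price `t` each. -/
lemma sum_min_singularValues_le {ι : Type*} (S : Finset ι) (v : ι → E) (w : ι → F)
    (hv : ∀ j ∈ S, ‖v j‖ ≤ 1) (T : E →ₗ[𝕜] F) (hT : ∀ x, T x = ∑ j ∈ S, inner 𝕜 (v j) x • w j)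
    {t : ℝ} (ht : 0 ≤ t) :
    ∑ k : Fin (finrank 𝕜 E), min (T.singularValues k) t ≤ ∑ j ∈ S, min ‖w j‖ t := by
  classical
  let R : Finset ι → E →ₗ[𝕜] F := fun S' => ∑ j ∈ S', (innerₛₗ 𝕜 (v j)).smulRight (w j)
  have hR : ∀ S' x, R S' x = ∑ j ∈ S', inner 𝕜 (v j) x • w j := fun S' x => by
    simp [R, LinearMap.sum_apply]
  set S₁ := S.filter fun j => ‖w j‖ ≤ t
  set S₂ := S.filter fun j => ¬ ‖w j‖ ≤ t
  have hTR : T = R S₁ + R S₂ := by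
    ext x
    rw [LinearMap.add_apply, hT, hR, hR, Finset.sum_filter_add_sum_filter_not]
  have hrank : finrank 𝕜 (range (R S₂)) ≤ S₂.card := by
    have hsub : range (R S₂) ≤ Submodule.span 𝕜 (S₂.image w : Set F) := by
      rintro _ ⟨x, rfl⟩
      rw [hR]
      exact Submodule.sum_mem _ fun j hj => Submodule.smul_mem _ _
        (Submodule.subset_span (by exact_mod_cast Finset.mem_image_of_mem w hj))
    exact (Submodule.finrank_mono hsub).trans
      ((finrank_span_finset_le_card _).trans Finset.card_image_le)
  refine (sum_min_singularValues_le_of_add T _ _ hTR hrank ht).trans ?_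
  have hN := sum_singularValues_le S₁ v w (fun j hj => hv j (Finset.mem_of_mem_filter j hj))
    (R S₁) (hR S₁)
  rw [← Finset.sum_filter_add_sum_filter_not S (fun j => ‖w j‖ ≤ t)]
  refine add_le_add (hN.trans (Finset.sum_le_sum fun j hj => ?_)) ?_
  · rw [min_eq_left (Finset.mem_filter.1 hj).2]
  · rw [Finset.sum_congr rfl fun j hj => min_eq_right (not_le.1 (Finset.mem_filter.1 hj).2).le]
    simp [S₂]

lemma sum_min_singularValues_add_le (A B : E →ₗ[𝕜] F) {t : ℝ} (ht : 0 ≤ t) :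
    ∑ k : Fin (finrank 𝕜 E), min ((A + B).singularValues k) t ≤
      ∑ k : Fin (finrank 𝕜 E), min (A.singularValues k) t +
        ∑ k : Fin (finrank 𝕜 E), min (B.singularValues k) t := by
  have key : ∀ (T : E →ₗ[𝕜] F) x,
      T x = ∑ j, inner 𝕜 (T.rightSingularBasis j) x • T (T.rightSingularBasis j) := fun T x => by
    conv_lhs => rw [← T.rightSingularBasis.sum_repr' x, map_sum]
    simp
  have h := sum_min_singularValues_le (ι := Fin (finrank 𝕜 E) ⊕ Fin (finrank 𝕜 E)) Finset.univ
    (Sum.elim A.rightSingularBasis B.rightSingularBasis)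
    (Sum.elim (fun j => A (A.rightSingularBasis j)) (fun j => B (B.rightSingularBasis j)))
    (by rintro (j | j) - <;> simp) (A + B)
    (fun x => by
      rw [Fintype.sum_sum_type, LinearMap.add_apply]
      exact congrArg₂ (· + ·) (key A x) (key B x)) ht
  simpa [Fintype.sum_sum_type, norm_apply_rightSingularBasis] using h

end LinearMap

/-! ### The penalty as a mixture of truncations -/

noncomputable section

namespace MPCP

open MeasureTheory

lemma mpcp_zero {τ p : ℝ} (hτ : 0 < τ) (hp : 0 < p) : mpcp τ p 0 = 0 := by
  have : (0 : ℝ) ^ (1 + p) = 0 := Real.zero_rpow (by linarith)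
  simp [mpcp, this, Real.rpow_nonneg hτ.le]

/-- The weight may blow up at `0`, but `p - 1 > -1` keeps it integrable. -/
lemma intervalIntegrable_mpcp_weight {p : ℝ} (hp : 0 < p) (g : ℝ → ℝ) (hg : Continuous g)
    (c a b : ℝ) : IntervalIntegrable (fun t => g t * (c * t ^ (p - 1))) volume a b :=
  ((intervalIntegral.intervalIntegrable_rpow' (by linarith)).const_mul c).continuousOn_mul
    hg.continuousOn

lemma integral_weight_mul {τ p : ℝ} (hp : 0 < p) {x : ℝ} (hx : 0 ≤ x) :
    ∫ t in (0 : ℝ)..x, t * (p / τ * t ^ (p - 1)) = p / τ * (x ^ (1 + p) / (1 + p)) := by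
  have h : ∀ t ∈ Set.uIcc 0 x, t * (p / τ * t ^ (p - 1)) = p / τ * t ^ p := by
    intro t ht
    rw [Set.uIcc_of_le hx] at ht
    rcases ht.1.eq_or_lt with h0 | h0
    · simp [← h0, Real.zero_rpow hp.ne']
    · rw [Real.rpow_sub_one h0.ne']
      field_simp
  rw [intervalIntegral.integral_congr h, intervalIntegral.integral_const_mul,
    integral_rpow (Or.inl (by linarith)), Real.zero_rpow (by linarith), sub_zero, add_comm p 1]

/-- On the nonnegative reals, `mpcp τ p` is a mixture of the functions `x ↦ min x t`. -/
lemma mpcp_eq_integral {τ p : ℝ} (hτ : 0 < τ) (hp : 0 < p) {x : ℝ} (hx : 0 ≤ x) :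
    mpcp τ p x = ∫ t in (0 : ℝ)..τ ^ (1 / p), min x t * (p / τ * t ^ (p - 1)) := by
  set a := τ ^ (1 / p) with ha
  have ha0 : 0 < a := Real.rpow_pos_of_pos hτ _
  -- This makes the total mass of the weight on `[0, a]` equal to `1`, matching the slope of the
  -- penalty at `0`.
  have hap : a ^ p = τ := by
    rw [ha, ← Real.rpow_mul hτ.le, one_div_mul_cancel hp.ne', Real.rpow_one]
  have hint := fun b c => intervalIntegrable_mpcp_weight hp (fun t => min x t) (by fun_prop)
    (p / τ) b c
  have hp1 : 1 + p ≠ 0 := by linarith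
  unfold mpcp
  rw [abs_of_nonneg hx]
  split_ifs with hxa
  · rw [← intervalIntegral.integral_add_adjacent_intervals (hint 0 x) (hint x a)]
    have h1 : ∫ t in (0 : ℝ)..x, min x t * (p / τ * t ^ (p - 1)) =
        ∫ t in (0 : ℝ)..x, t * (p / τ * t ^ (p - 1)) :=
      intervalIntegral.integral_congr fun t ht => by
        rw [Set.uIcc_of_le hx] at ht
        simp only [min_eq_right ht.2]
    have h2 : ∫ t in x..a, min x t * (p / τ * t ^ (p - 1)) =
        ∫ t in x..a, x * (p / τ * t ^ (p - 1)) :=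
      intervalIntegral.integral_congr fun t ht => by
        rw [Set.uIcc_of_le hxa] at ht
        simp only [min_eq_left ht.1]
    rw [h1, h2, integral_weight_mul hp hx, intervalIntegral.integral_const_mul,
      intervalIntegral.integral_const_mul, integral_rpow (Or.inl (by linarith)), sub_add_cancel,
      hap, Real.rpow_add_of_nonneg hx zero_le_one hp.le, Real.rpow_one]
    field_simp
    ring
  · have h1 : ∫ t in (0 : ℝ)..a, min x t * (p / τ * t ^ (p - 1)) =
        ∫ t in (0 : ℝ)..a, t * (p / τ * t ^ (p - 1)) :=
      intervalIntegral.integral_congr fun t ht => by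
        rw [Set.uIcc_of_le ha0.le] at ht
        simp only [min_eq_right (ht.2.trans (not_le.1 hxa).le)]
    rw [h1, integral_weight_mul hp ha0.le, Real.rpow_add ha0, Real.rpow_one, hap,
      ← ha]
    field_simp

lemma mpcp_pos {τ p : ℝ} (hτ : 0 < τ) (hp : 0 < p) {x : ℝ} (hx : 0 < x) : 0 < mpcp τ p x := by
  rw [mpcp_eq_integral hτ hp hx.le]
  refine intervalIntegral.intervalIntegral_pos_of_pos_on
    (intervalIntegrable_mpcp_weight hp (fun t => min x t) (by fun_prop) _ _ _) (fun t ht => ?_)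
    (Real.rpow_pos_of_pos hτ _)
  have := Real.rpow_pos_of_pos ht.1 (p - 1)
  have := lt_min hx ht.1
  positivity

lemma mpcp_nonneg {τ p : ℝ} (hτ : 0 < τ) (hp : 0 < p) {x : ℝ} (hx : 0 ≤ x) : 0 ≤ mpcp τ p x := by
  rcases hx.eq_or_lt with rfl | h
  · exact (mpcp_zero hτ hp).ge
  · exact (mpcp_pos hτ hp h).le

lemma sum_mpcp_eq_integral {ι : Type*} (S : Finset ι) {τ p : ℝ} (hτ : 0 < τ) (hp : 0 < p)
    (s : ι → ℝ) (hs : ∀ i, 0 ≤ s i) :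
    ∑ i ∈ S, mpcp τ p (s i) =
      ∫ t in (0 : ℝ)..τ ^ (1 / p), (∑ i ∈ S, min (s i) t) * (p / τ * t ^ (p - 1)) := by
  simp_rw [Finset.sum_mul]
  rw [intervalIntegral.integral_finsetSum fun i _ =>
    intervalIntegrable_mpcp_weight hp (fun t => min (s i) t) (by fun_prop) _ _ _]
  exact Finset.sum_congr rfl fun i _ => mpcp_eq_integral hτ hp (hs i)

/-! ### The matrix norm -/

section Matrix

variable {m n : ℕ}

lemma singularValue_nonneg (A : Matrix (Fin m) (Fin n) ℂ) (i : ℕ) : 0 ≤ singularValue A i :=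
  LinearMap.singularValues_nonneg _ _

lemma singularValue_eq_zero_of_min_le (A : Matrix (Fin m) (Fin n) ℂ) {i : ℕ} (hi : min m n ≤ i) :
    singularValue A i = 0 := by
  by_contra h
  have h' := (LinearMap.singularValues_pos_iff_ne_zero _ i).2 h
  rw [LinearMap.singularValues_pos_iff_lt_finrank_range] at h'
  have h1 := Submodule.finrank_le (LinearMap.range (Matrix.toEuclideanLin A))
  have h2 := LinearMap.finrank_range_le (Matrix.toEuclideanLin A)
  rw [finrank_euclideanSpace_fin] at h1 h2
  omega

/-- Pads the sum with zeros, as `ψ(0) = 0`, so that it runs over the dimension of the domain as in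
the operator lemmas. -/
lemma matrixNorm_eq_sum {τ p : ℝ} (hτ : 0 < τ) (hp : 0 < p) (A : Matrix (Fin m) (Fin n) ℂ) :
    matrixNorm τ p A = ∑ i : Fin (Module.finrank ℂ (EuclideanSpace ℂ (Fin n))),
      mpcp τ p ((Matrix.toEuclideanLin A).singularValues i) := by
  unfold matrixNorm
  rw [Fin.sum_univ_eq_sum_range (fun i => mpcp τ p (singularValue A i)),
    Fin.sum_univ_eq_sum_range (fun i => mpcp τ p ((Matrix.toEuclideanLin A).singularValues i)),
    finrank_euclideanSpace_fin]
  refine Finset.sum_subset (Finset.range_subset_range.2 (min_le_right _ _)) fun i _ hi => ?_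
  rw [singularValue_eq_zero_of_min_le A (not_lt.1 fun h => hi (Finset.mem_range.2 h)), mpcp_zero hτ hp]

lemma matrixNorm_nonneg {τ p : ℝ} (hτ : 0 < τ) (hp : 0 < p) (A : Matrix (Fin m) (Fin n) ℂ) :
    0 ≤ matrixNorm τ p A :=
  Finset.sum_nonneg fun _ _ => mpcp_nonneg hτ hp (singularValue_nonneg A _)

lemma matrixNorm_eq_zero {τ p : ℝ} (hτ : 0 < τ) (hp : 0 < p) {A : Matrix (Fin m) (Fin n) ℂ} :
    matrixNorm τ p A = 0 ↔ A = 0 := by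
  rw [matrixNorm_eq_sum hτ hp, Finset.sum_eq_zero_iff_of_nonneg fun i _ =>
    mpcp_nonneg hτ hp (LinearMap.singularValues_nonneg _ _)]
  constructor
  · intro h
    have hs : ∀ i : Fin (Module.finrank ℂ (EuclideanSpace ℂ (Fin n))),
        (Matrix.toEuclideanLin A).singularValues i = 0 := by
      intro i
      by_contra h0
      exact (mpcp_pos hτ hp ((LinearMap.singularValues_pos_iff_ne_zero _ _).2 h0)).ne'
        (h i (Finset.mem_univ i))
    apply Matrix.toEuclideanLin.injective
    rw [map_zero]
    refine LinearMap.ext fun x => ?_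
    have := (Matrix.toEuclideanLin A).norm_apply_sq_eq_sum x
    simp only [hs] at this
    simpa using this
  · rintro rfl i -
    have h : (Matrix.toEuclideanLin (0 : Matrix (Fin m) (Fin n) ℂ)).singularValues i = 0 := by
      rw [← LinearMap.norm_apply_rightSingularBasis]
      simp
    rw [h, mpcp_zero hτ hp]

lemma matrixNorm_add_le {τ p : ℝ} (hτ : 0 < τ) (hp : 0 < p) (A B : Matrix (Fin m) (Fin n) ℂ) :
    matrixNorm τ p (A + B) ≤ matrixNorm τ p A + matrixNorm τ p B := by
  simp only [matrixNorm_eq_sum hτ hp, map_add]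
  simp only [sum_mpcp_eq_integral _ hτ hp _ fun i => LinearMap.singularValues_nonneg _ _]
  have hint := fun T : EuclideanSpace ℂ (Fin n) →ₗ[ℂ] EuclideanSpace ℂ (Fin m) =>
    intervalIntegrable_mpcp_weight hp (fun t => ∑ i : Fin (Module.finrank ℂ
      (EuclideanSpace ℂ (Fin n))), min (T.singularValues i) t) (by fun_prop) (p / τ) 0 (τ ^ (1 / p))
  rw [← intervalIntegral.integral_add (hint _) (hint _)]
  refine intervalIntegral.integral_mono_on (Real.rpow_nonneg hτ.le _) (hint _)
    ((hint _).add (hint _)) fun t ht => ?_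
  rw [← add_mul]
  have := Real.rpow_nonneg ht.1 (p - 1)
  gcongr
  exact LinearMap.sum_min_singularValues_add_le _ _ ht.1

lemma norm_toEuclideanLin_of_conjTranspose_mul {U : Matrix (Fin n) (Fin n) ℂ}
    (hU : U.conjTranspose * U = 1) (x : EuclideanSpace ℂ (Fin n)) :
    ‖Matrix.toEuclideanLin U x‖ = ‖x‖ := by
  have h : inner ℂ (Matrix.toEuclideanLin U x) (Matrix.toEuclideanLin U x) = inner ℂ x x := by
    rw [← LinearMap.adjoint_inner_right, ← Matrix.toEuclideanLin_conjTranspose_eq_adjoint,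
      ← LinearMap.comp_apply, ← Matrix.toLpLin_mul_same, hU, Matrix.toLpLin_one,
      LinearMap.id_apply]
  rw [inner_self_eq_norm_sq_to_K, inner_self_eq_norm_sq_to_K] at h
  exact (sq_eq_sq₀ (norm_nonneg _) (norm_nonneg _)).1 (by exact_mod_cast h)

lemma matrixNorm_mul_mul (τ p : ℝ) {U : Matrix (Fin m) (Fin m) ℂ} {V : Matrix (Fin n) (Fin n) ℂ}
    (hU : U.conjTranspose * U = 1) (hV : V.conjTranspose * V = 1)
    (A : Matrix (Fin m) (Fin n) ℂ) : matrixNorm τ p (U * A * V) = matrixNorm τ p A := by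
  let e : EuclideanSpace ℂ (Fin n) ≃ₗᵢ[ℂ] EuclideanSpace ℂ (Fin n) :=
    LinearIsometry.toLinearIsometryEquiv
      ⟨Matrix.toEuclideanLin V, norm_toEuclideanLin_of_conjTranspose_mul hV⟩ rfl
  unfold matrixNorm singularValue
  rw [LinearMap.singularValues_eq_of_norm_eq (Matrix.toEuclideanLin (U * A * V))
    (Matrix.toEuclideanLin A) e fun x => by
      rw [Matrix.mul_assoc, Matrix.toLpLin_mul_same, LinearMap.comp_apply,
        norm_toEuclideanLin_of_conjTranspose_mul hU, Matrix.toLpLin_mul_same]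
      rfl]

end Matrix

end MPCP

end

/-! ### The Fourier transform and the t-product -/

noncomputable section

namespace MPCP

variable {𝕜 : Type*} [RCLike 𝕜] {J₁ J₂ I J₃ : ℕ}

lemma toComplex_zero : toComplex (0 : 𝕜) = 0 := by
  apply Complex.ext <;> simp [toComplex]

lemma toComplex_one : toComplex (1 : 𝕜) = 1 := by
  apply Complex.ext <;> simp [toComplex]

lemma toComplex_add (a b : 𝕜) : toComplex (a + b) = toComplex a + toComplex b := by
  apply Complex.ext <;> simp [toComplex]

lemma toComplex_sub (a b : 𝕜) : toComplex (a - b) = toComplex a - toComplex b := by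
  apply Complex.ext <;> simp [toComplex]

lemma toComplex_mul (a b : 𝕜) : toComplex (a * b) = toComplex a * toComplex b := by
  apply Complex.ext <;> simp [toComplex]

lemma toComplex_star (a : 𝕜) : toComplex (star a) = star (toComplex a) := by
  apply Complex.ext <;> simp [toComplex]

lemma toComplex_sum {ι : Type*} (S : Finset ι) (f : ι → 𝕜) :
    toComplex (∑ i ∈ S, f i) = ∑ i ∈ S, toComplex (f i) :=
  map_sum (AddMonoidHom.mk' (toComplex : 𝕜 → ℂ) toComplex_add) f S

lemma toComplex_eq_zero {a : 𝕜} (h : toComplex a = 0) : a = 0 :=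
  RCLike.ext (by simpa [toComplex] using congrArg Complex.re h)
    (by simpa [toComplex] using congrArg Complex.im h)

/-- The root of unity of the discrete Fourier transform. -/
def dftRoot (J₃ : ℕ) : ℂ := Complex.exp (-(2 * Real.pi * Complex.I) / J₃)

lemma isPrimitiveRoot_dftRoot [NeZero J₃] : IsPrimitiveRoot (dftRoot J₃) J₃ := by
  rw [dftRoot, neg_div, Complex.exp_neg]
  exact (Complex.isPrimitiveRoot_exp J₃ (NeZero.ne J₃)).inv

lemma dftRoot_pow_mul_val_add [NeZero J₃] (m : ℕ) (a b : Fin J₃) :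
    dftRoot J₃ ^ (m * ((a + b : Fin J₃) : ℕ)) =
      dftRoot J₃ ^ (m * (a : ℕ)) * dftRoot J₃ ^ (m * (b : ℕ)) := by
  rw [← pow_add, ← mul_add]
  refine pow_eq_pow_of_modEq (n := J₃) ?_ isPrimitiveRoot_dftRoot.pow_eq_one
  rw [Fin.val_add]
  exact (Nat.mod_modEq _ _).mul_left m

lemma star_dftRoot_pow_mul_val [NeZero J₃] (m : ℕ) (a : Fin J₃) :
    star (dftRoot J₃ ^ (m * (a : ℕ))) = dftRoot J₃ ^ (m * ((-a : Fin J₃) : ℕ)) := by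
  have h : dftRoot J₃ ^ (m * (a : ℕ)) * dftRoot J₃ ^ (m * ((-a : Fin J₃) : ℕ)) = 1 := by
    rw [← dftRoot_pow_mul_val_add]
    simp
  have hn : ‖dftRoot J₃ ^ (m * (a : ℕ))‖ = 1 := by
    rw [norm_pow, isPrimitiveRoot_dftRoot.norm'_eq_one (NeZero.ne J₃), one_pow]
  rw [eq_inv_of_mul_eq_one_right h, Complex.star_def, Complex.inv_eq_conj hn]

lemma fft_apply (B : Tensor 𝕜 J₁ J₂ J₃) (k : Fin J₃) (i : Fin J₁) (j : Fin J₂) :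
    fft B k i j = ∑ l : Fin J₃, dftRoot J₃ ^ ((k : ℕ) * (l : ℕ)) * toComplex (B l i j) := rfl

lemma fft_sub (B C : Tensor 𝕜 J₁ J₂ J₃) (k : Fin J₃) : fft (B - C) k = fft B k - fft C k := by
  ext i j
  simp only [fft_apply, Matrix.sub_apply, Pi.sub_apply, toComplex_sub, mul_sub,
    Finset.sum_sub_distrib]

/-- The transform is a Vandermonde matrix at the distinct powers of a primitive root, hence
invertible. -/
lemma fft_eq_zero [NeZero J₃] {B : Tensor 𝕜 J₁ J₂ J₃} : (∀ k, fft B k = 0) ↔ B = 0 := by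
  constructor
  · intro h
    have hdet : (Matrix.vandermonde fun k : Fin J₃ => dftRoot J₃ ^ (k : ℕ)).det ≠ 0 :=
      Matrix.det_vandermonde_ne_zero_iff.2 fun a b hab =>
        Fin.ext (isPrimitiveRoot_dftRoot.pow_inj a.2 b.2 hab)
    funext l
    ext i j
    refine toComplex_eq_zero (congrFun (Matrix.eq_zero_of_mulVec_eq_zero hdet
      (v := fun l => toComplex (B l i j)) (funext fun k => ?_)) l)
    have := congrFun (congrFun (h k) i) j
    rw [fft_apply] at this
    simpa [Matrix.mulVec, dotProduct, Matrix.vandermonde_apply, ← pow_mul] using this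
  · rintro rfl k
    ext i j
    simp [fft_apply, toComplex_zero]

lemma tProd_apply (B : Tensor 𝕜 J₁ J₂ J₃) (C : Tensor 𝕜 J₂ I J₃) (k : Fin J₃) (i : Fin J₁)
    (j : Fin I) : tProd B C k i j = ∑ l, ∑ q, B (k - l) i q * C l q j := by
  simp only [tProd, bvfold, bcirc, bvec, Matrix.of_apply, Matrix.mul_apply,
    Fintype.sum_prod_type]

lemma fft_tProd [NeZero J₃] (B : Tensor 𝕜 J₁ J₂ J₃) (C : Tensor 𝕜 J₂ I J₃) (k : Fin J₃) :
    fft (tProd B C) k = fft B k * fft C k := by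
  ext i j
  simp only [fft_apply, Matrix.mul_apply, tProd_apply, toComplex_sum, toComplex_mul,
    Finset.sum_mul_sum]
  simp only [Finset.mul_sum]
  rw [Finset.sum_comm]
  have h : ∀ l : Fin J₃, ∑ s : Fin J₃, ∑ q : Fin J₂, dftRoot J₃ ^ ((k : ℕ) * (s : ℕ)) *
        (toComplex (B (s - l) i q) * toComplex (C l q j)) =
      ∑ s : Fin J₃, ∑ q : Fin J₂, dftRoot J₃ ^ ((k : ℕ) * (s : ℕ)) * toComplex (B s i q) *
        (dftRoot J₃ ^ ((k : ℕ) * (l : ℕ)) * toComplex (C l q j)) := by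
    intro l
    -- Shifting `s` by `l` undoes the cyclic convolution, and the root power splits as a character
    -- of `ℤ/J₃`.
    rw [← Equiv.sum_comp (Equiv.addRight l)]
    refine Finset.sum_congr rfl fun s _ => Finset.sum_congr rfl fun q _ => ?_
    rw [Equiv.coe_addRight, add_sub_cancel_right, dftRoot_pow_mul_val_add]
    ring
  rw [Finset.sum_congr rfl fun l _ => h l, Finset.sum_comm]
  exact (Finset.sum_comm.trans (Finset.sum_congr rfl fun s _ => Finset.sum_comm)).symm

lemma fft_tConjTranspose [NeZero J₃] (B : Tensor 𝕜 J₁ J₂ J₃) (k : Fin J₃) :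
    fft (tConjTranspose B) k = (fft B k).conjTranspose := by
  ext i j
  simp only [fft_apply, Matrix.conjTranspose_apply, tConjTranspose, toComplex_star, star_sum,
    star_mul', star_dftRoot_pow_mul_val]
  rw [← Equiv.sum_comp (Equiv.neg (Fin J₃))]
  simp

lemma fft_idTensor [NeZero J₃] (k : Fin J₃) : fft (idTensor 𝕜 J₁ J₃) k = 1 := by
  ext i j
  rw [fft_apply, Finset.sum_eq_single 0]
  · by_cases h : i = j <;> simp [idTensor, h, toComplex_zero, toComplex_one, Matrix.one_apply]
  · intro l _ hl
    simp [idTensor, hl, toComplex_zero]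
  · simp

lemma IsUnitary.conjTranspose_fft_mul_fft [NeZero J₃] {Q : Tensor 𝕜 J₁ J₁ J₃} (hQ : IsUnitary Q)
    (k : Fin J₃) : (fft Q k).conjTranspose * fft Q k = 1 := by
  rw [← fft_tConjTranspose, ← fft_tProd, hQ.2, fft_idTensor]

/-! ### The tensor norm -/

lemma tensorNorm_nonneg {τ p : ℝ} (hτ : 0 < τ) (hp : 0 < p) (B : Tensor 𝕜 J₁ J₂ J₃) :
    0 ≤ tensorNorm τ p B :=
  mul_nonneg (by positivity) (Finset.sum_nonneg fun _ _ => matrixNorm_nonneg hτ hp _)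

lemma tensorNorm_eq_zero [NeZero J₃] {τ p : ℝ} (hτ : 0 < τ) (hp : 0 < p)
    {B : Tensor 𝕜 J₁ J₂ J₃} : tensorNorm τ p B = 0 ↔ B = 0 := by
  have hJ : (1 / (J₃ : ℝ)) ≠ 0 := one_div_ne_zero (Nat.cast_ne_zero.2 (NeZero.ne J₃))
  rw [tensorNorm, mul_eq_zero, or_iff_right hJ,
    Finset.sum_eq_zero_iff_of_nonneg fun _ _ => matrixNorm_nonneg hτ hp _, ← fft_eq_zero]
  simp [matrixNorm_eq_zero hτ hp]

lemma tensorNorm_tProd_tProd [NeZero J₃] (τ p : ℝ) {U : Tensor 𝕜 J₁ J₁ J₃}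
    {V : Tensor 𝕜 J₂ J₂ J₃} (hU : IsUnitary U) (hV : IsUnitary V) (B : Tensor 𝕜 J₁ J₂ J₃) :
    tensorNorm τ p (tProd (tProd U B) V) = tensorNorm τ p B := by
  simp only [tensorNorm, fft_tProd, matrixNorm_mul_mul τ p (hU.conjTranspose_fft_mul_fft _)
    (hV.conjTranspose_fft_mul_fft _)]

lemma tensorNorm_sub_ge {τ p : ℝ} (hτ : 0 < τ) (hp : 0 < p) (C D : Tensor 𝕜 J₁ J₂ J₃) :
    tensorNorm τ p C - tensorNorm τ p D ≤ tensorNorm τ p (C - D) := by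
  simp only [tensorNorm]
  rw [← mul_sub, ← Finset.sum_sub_distrib]
  gcongr with k
  -- Subadditivity for the splitting `C = (C - D) + D`, slice by slice.
  have := matrixNorm_add_le hτ hp (fft C k - fft D k) (fft D k)
  rw [sub_add_cancel] at this
  rw [fft_sub]
  linarith

end MPCP

end

theorem theorem3 {𝕜 : Type*} [RCLike 𝕜] (J₁ J₂ J₃ : ℕ) [NeZero J₃]
    (τ p : ℝ) (hτ : 1 < τ) (hp₀ : 0 < p) (hp₁ : p < 1) :
    (∀ B : MPCP.Tensor 𝕜 J₁ J₂ J₃,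
      0 ≤ MPCP.tensorNorm τ p B ∧ (MPCP.tensorNorm τ p B = 0 ↔ B = 0)) ∧
    (∀ (U : MPCP.Tensor 𝕜 J₁ J₁ J₃) (B : MPCP.Tensor 𝕜 J₁ J₂ J₃) (V : MPCP.Tensor 𝕜 J₂ J₂ J₃),
      MPCP.IsUnitary U → MPCP.IsUnitary V →
        MPCP.tensorNorm τ p (MPCP.tProd (MPCP.tProd U B) V) = MPCP.tensorNorm τ p B) ∧
    (∀ C D : MPCP.Tensor 𝕜 J₁ J₂ J₃,
      MPCP.tensorNorm τ p (C - D) ≥ MPCP.tensorNorm τ p C - MPCP.tensorNorm τ p D) := by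
  have hτ' : 0 < τ := one_pos.trans hτ
  exact ⟨fun B => ⟨MPCP.tensorNorm_nonneg hτ' hp₀ B, MPCP.tensorNorm_eq_zero hτ' hp₀⟩,
    fun U B V hU hV => MPCP.tensorNorm_tProd_tProd τ p hU hV B,
    fun C D => MPCP.tensorNorm_sub_ge hτ' hp₀ C D⟩
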